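/- For each $n\ge 1$ let $p=p_n$ be a positive integer, where $p_n\ge n^{C}$ for all large $n$ and some constant $C>0$, and let $\theta_0=\theta_{0,n}\in\mathbb R^{p}$ be nonzero, with support $S_0=\{j:\theta_{0,j}\neq 0\}$ and $s_0=|S_0|$. Let $\mathbf X=(X_{ij})\in\mathbb R^{n\times p}$ be a random matrix whose entries are i.i.d. $\mathcal N(0,1)$. Write $X_i\in\mathbb R^p$ for its $i$th row, $\mathbf X_j$ for its $j$th column, $X_{i,S}$ and $\mathbf X_S$ for the restrictions of $X_i$ and $\mathbf X$ to the coordinates (columns) in $S\subseteq\{1,\dots,p\}$. For a matrix $A=(a_{ij})$ put $\|A\|_{\max}=\max_{i,j}|a_{ij}|$ and $\|A\|_\infty=\max_i\sum_j|a_{ij}|$. Then: (1) With probability converging to $1$ as $n\to\infty$, $$\|\mathbf X\|_{\max}\le 2\sqrt{\log(np)},\qquad \|\mathbf X_{S_0}\|_\infty\le 2s_0\sqrt{\log(np)},$$ $$\max_{1\le j\le p}\|\mathbf X_j\|_2\le\sqrt n+2\sqrt{\log p},\qquad \max_{1\le i\le n}|X_i^\top\theta_0|\le 2\|\theta_0\|_2\sqrt{\log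 n}.$$ (2) Let $b:\mathbb R\to\mathbb R$ be strictly convex and three times differentiable (the cumulant function of a generalized linear model with canonical link), and let $K_{\rm dim}>1$ and $K_{\rm theta}>0$ be constants. Put $s_n=K_{\rm dim}s_0$, $\widetilde s_n=(K_{\rm dim}+1)s_0$, $\mathscr S_s=\{S\subseteq\{1,\dots,p\}:|S|\le s\}$, $F=\sum_{i=1}^n b''(X_i^\top\theta_0)X_iX_i^\top$, let $\mathscr S_{\Theta_n}$ be the set of all $S\in\mathscr S_{s_n}$ for which some $v\in\mathbb R^p$ vanishing outside $S$ satisfies $\|F^{1/2}(v-\theta_0)\|_2^2\le K_{\rm theta}\,s_0\log p$, and let $\overline{\mathscr S}_{\Theta_n}=\mathscr S_{\Theta_n}\cup\{S\cup S_0:S\in\mathscr S_{\Theta_n}\}$. If $$(s_0^2\log p)\vee(s_0\log p)^{3/2}=o(n),$$ then, with probability converging to $1$ as $n\to\infty$, $\mathbf X_S^\top\mathbf X_S$ is invertible for all $S\in\mathscr S_{\widetilde s_n}$, $$\max_{S\in\mathscr S_{\widetilde s_n}}\bigl\|(\mathbf X_S^\top\mathbf X_S)^{-1}\bigr\|_\infty\le\frac{K_\infty}{n}\qquad\text{and}\qquad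 \max_{S\in\overline{\mathscr S}_{\Theta_n}}\ \sup_{u\in\mathbb R^{S},\,\|u\|_2=1}\ \frac1n\sum_{i=1}^n|X_{i,S}^\top u|^3\le K_{\rm cubic},$$ where $K_\infty,K_{\rm cubic}>0$ are universal constants. -/

import Mathlib

open MeasureTheory ProbabilityTheory Filter Topology Asymptotics
open scoped Matrix MatrixOrder

noncomputable section

namespace SparseGLM

variable {m k : Type*} {p n : ℕ}

/-- The max-norm `max_{i,j} |a_{ij}|` of a real matrix with finite index types
(an empty maximum of absolute values is `0`). -/
def maxNorm (A : Matrix m k ℝ) : ℝ := ⨆ i, ⨆ j, |A i j|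

/-- The maximal absolute row sum `max_i ∑_j |a_{ij}|`. -/
def inftyNorm [Fintype k] (A : Matrix m k ℝ) : ℝ := ⨆ i, ∑ j, |A i j|

/-- The largest Euclidean norm of a column. -/
def maxColNorm [Fintype m] (A : Matrix m k ℝ) : ℝ := ⨆ j, ‖WithLp.toLp 2 (fun i => A i j)‖

/-- The index set of the nonzero coordinates of `θ`. -/
def supp (θ : EuclideanSpace ℝ (Fin p)) : Finset (Fin p) :=
  Finset.univ.filter fun j => θ j ≠ 0

/-- The submatrix `X_S` of the columns with index in `S`. -/
def cols (X : Matrix (Fin n) (Fin p) ℝ) (S : Finset (Fin p)) : Matrix (Fin n) S ℝ :=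
  X.submatrix id Subtype.val

/-- The `p`-vector that agrees with `v` on `S` and is zero off `S`. -/
def zeroExt (S : Finset (Fin p)) (v : EuclideanSpace ℝ S) : EuclideanSpace ℝ (Fin p) :=
  WithLp.toLp 2 fun j => if h : j ∈ S then v ⟨j, h⟩ else 0

/-- The supports of cardinality at most `s` (a real number, as `s` is a real multiple of the
true sparsity). -/
def sparseSupports (p : ℕ) (s : ℝ) : Set (Finset (Fin p)) := {S | (S.card : ℝ) ≤ s}

/-- The Fisher information `Xᵀ W_θ X`, `W_θ = diag (b''(X_iᵀ θ))`, of the generalized linear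
model with canonical link and cumulant function `b`. -/
def fisher (b : ℝ → ℝ) (X : Matrix (Fin n) (Fin p) ℝ) (θ : EuclideanSpace ℝ (Fin p)) :
    Matrix (Fin p) (Fin p) ℝ :=
  Xᵀ * Matrix.diagonal (fun i => iteratedDeriv 2 b ((X *ᵥ θ.ofLp) i)) * X

/-- The Euclidean norm `‖F^{1/2} v‖₂`, where `F^{1/2}` is the positive semidefinite square root
of the positive semidefinite matrix `F`. -/
def sqrtNorm (F : Matrix (Fin p) (Fin p) ℝ) (v : EuclideanSpace ℝ (Fin p)) : ℝ :=
  ‖WithLp.toLp 2 (CFC.sqrt F *ᵥ v.ofLp)‖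

/-- The nearly well-specified supports: `|S| ≤ Kdim s₀`, and some vector `v` supported on `S`
satisfies `‖F_{θ₀}^{1/2} (v - θ₀)‖₂² ≤ Ktheta s₀ log p`. -/
def nearSupports (b : ℝ → ℝ) (Kdim Ktheta : ℝ) (θ₀ : EuclideanSpace ℝ (Fin p))
    (X : Matrix (Fin n) (Fin p) ℝ) : Set (Finset (Fin p)) :=
  {S | S ∈ sparseSupports p (Kdim * (supp θ₀).card) ∧
    ∃ v : EuclideanSpace ℝ S, sqrtNorm (fisher b X θ₀) (zeroExt S v - θ₀) ^ 2
      ≤ Ktheta * (supp θ₀).card * Real.log p}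

/-- The nearly well-specified supports, together with their unions with the true support. -/
def nearSupportsBar (b : ℝ → ℝ) (Kdim Ktheta : ℝ) (θ₀ : EuclideanSpace ℝ (Fin p))
    (X : Matrix (Fin n) (Fin p) ℝ) : Set (Finset (Fin p)) :=
  nearSupports b Kdim Ktheta θ₀ X ∪
    (fun S => S ∪ supp θ₀) '' nearSupports b Kdim Ktheta θ₀ X

/-- `A n` holds with `P n`-probability converging to one. Inner events are used so that nothing
depends on the measurability of `A n`; for measurable `A n` this says `P n (A n) → 1`. -/
def WithProbTendingToOne {Ω : ℕ → Type*} [∀ n, MeasurableSpace (Ω n)]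
    (P : ∀ n, Measure (Ω n)) (A : ∀ n, Ω n → Prop) : Prop :=
  ∃ E : ∀ n, Set (Ω n), (∀ n, MeasurableSet (E n)) ∧ (∀ n, ∀ ω ∈ E n, A n ω) ∧
    Tendsto (fun n => P n (E n)) atTop (𝓝 1)

end SparseGLM

end

open SparseGLM

/-!
Every event is reduced to one fact: for a unit vector `u` the vector `X u` is standard Gaussian in
`ℝⁿ` (`isIsotropicGaussian_of_iid`). The norm bounds of the first part are union bounds over
Gaussian and chi-square tails.

For the inverse Gram matrices no uniform spectral bound is needed. By polarization every entry of
`XᵀX / n - I` is controlled by chi-square deviations, hence is at most `1 / (2σ)` with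
`σ = (Kdim + 1) s₀`, uniformly over all pairs of columns: the failure probability of one pair is of
order `exp (-n / (72 σ²))`, which beats the `p²` pairs since `s₀² log p = o(n)`. A submatrix of size
at most `σ` then has row sums at most `1 / 2` off the identity, and a Neumann-type argument
(`isUnit_and_inftyNorm_inv_le`) bounds the row sums of its inverse by `2 / n`.

For the third moments it suffices to bound `‖X u‖₃` over all `σ`-sparse unit vectors, as all
supports in question have at most `σ` elements (`nearSupportsBar_subset`). For one `u`,
`∑ |(X u)_i|³ ≤ A n` fails with probability at most `4 exp (-n^{2/3} / 8)`
(`exists_stdGaussianPi_sum_cube`): the entries below `n^{1/9}` obey a Chernoff bound, and the larger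
ones satisfy `∑ z_i² ≤ n^{2/3}`, which gives `∑ z_i³ ≤ n`. The sparse vectors with coordinates in a
grid of mesh `1 / p` form a net of at most `p^{3σ}` elements (for `p ≥ 3`), and `(s₀ log p)^{3/2} = o(n)` says
precisely that this is `exp (o(n^{2/3}))`. The passage from the net to the sphere is
`norm_cols_mulVec_le_of_grid`. The constants are `2` and `27 A`.
-/

namespace SparseGLM

/-! ### Exponential moments of the Gaussian law -/

theorem gaussian_exp_sq_eq (l x : ℝ) :
    gaussianPDFReal 0 1 x • Real.exp (l * x ^ 2)
      = (√(2 * Real.pi))⁻¹ * Real.exp (-(1 / 2 - l) * x ^ 2) := by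
  simp only [gaussianPDFReal, NNReal.coe_one, mul_one, sub_zero, smul_eq_mul, mul_assoc,
    ← Real.exp_add]
  ring_nf

theorem integrable_exp_mul_sq_gaussian {l : ℝ} (hl : l < 1 / 2) :
    Integrable (fun x : ℝ => Real.exp (l * x ^ 2)) (gaussianReal 0 1) := by
  rw [gaussianReal_of_var_ne_zero _ one_ne_zero,
    integrable_withDensity_iff_integrable_smul₀' (by fun_prop)
      (ae_of_all _ fun _ => gaussianPDF_lt_top)]
  simp only [toReal_gaussianPDF, gaussian_exp_sq_eq]
  exact (integrable_exp_neg_mul_sq (by linarith)).const_mul _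

theorem integral_exp_mul_sq_gaussian {l : ℝ} (hl : l < 1 / 2) :
    ∫ x : ℝ, Real.exp (l * x ^ 2) ∂(gaussianReal 0 1) = (√(1 - 2 * l))⁻¹ := by
  rw [integral_gaussianReal_eq_integral_smul one_ne_zero]
  simp only [gaussian_exp_sq_eq]
  rw [integral_const_mul, integral_gaussian, ← Real.sqrt_inv, ← Real.sqrt_inv,
    ← Real.sqrt_mul (by positivity)]
  congr 1
  have : 1 - 2 * l ≠ 0 := by linarith
  have : 1 / 2 - l ≠ 0 := by linarith
  field_simp

theorem integral_exp_three_eighths_mul_sq_gaussian :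
    ∫ x : ℝ, Real.exp (3 / 8 * x ^ 2) ∂(gaussianReal 0 1) = 2 := by
  rw [integral_exp_mul_sq_gaussian (by norm_num),
    show (1 - 2 * (3 / 8 : ℝ)) = (1 / 2) ^ 2 by norm_num, Real.sqrt_sq (by norm_num)]
  norm_num

/-- The Chernoff bound for a sum of functions of i.i.d. variables. -/
theorem pi_chernoff {n : ℕ} (μ : Measure ℝ) [IsProbabilityMeasure μ] (φ : ℝ → ℝ)
    (hφ : Integrable (fun x => Real.exp (φ x)) μ) (t : ℝ) :
    (Measure.pi fun _ : Fin n => μ).real {y | t ≤ ∑ i, φ (y i)}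
      ≤ Real.exp (-t) * (∫ x, Real.exp (φ x) ∂μ) ^ n := by
  have hint : Integrable (fun y : Fin n → ℝ => Real.exp (1 * ∑ i, φ (y i)))
      (Measure.pi fun _ : Fin n => μ) := by
    simp only [one_mul, Real.exp_sum]
    exact Integrable.fintype_prod (f := fun _ x => Real.exp (φ x)) fun _ => hφ
  have h := measure_ge_le_exp_mul_mgf (μ := Measure.pi fun _ : Fin n => μ)
    (X := fun y => ∑ i, φ (y i)) t zero_le_one hint
  refine h.trans_eq ?_
  rw [mgf, neg_one_mul]
  simp only [one_mul, Real.exp_sum]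
  rw [integral_fintype_prod_eq_prod (f := fun _ x => Real.exp (φ x))]
  simp

/-! ### Tails of norms of Gaussian vectors -/

/-- The standard Gaussian measure on `ℝⁿ`, as a product measure. -/
noncomputable abbrev stdGaussianPi (n : ℕ) : Measure (Fin n → ℝ) :=
  Measure.pi fun _ => gaussianReal 0 1

/-- The upper tail of a chi-square variable with the sharp constant, so that
`√n + t` can be read as a bound for a Euclidean norm. -/
theorem stdGaussianPi_sum_sq_gt {n : ℕ} {t : ℝ} (ht : 0 ≤ t) :
    (stdGaussianPi n).real {y | (√n + t) ^ 2 < ∑ i, y i ^ 2} ≤ Real.exp (-t ^ 2 / 2) := by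
  rcases Nat.eq_zero_or_pos n with rfl | hn
  · have : {y : Fin 0 → ℝ | (√(0 : ℕ) + t) ^ 2 < ∑ i, y i ^ 2} = ∅ := by
      ext y; simp [sq_nonneg]
    rw [this]; simp [Real.exp_nonneg]
  have hr : 0 < √(n : ℝ) := by positivity
  have hrn : √(n : ℝ) ^ 2 = n := Real.sq_sqrt (by positivity)
  set r := √(n : ℝ)
  have ha : 0 < r + t := by positivity
  -- The minimizer of the Chernoff exponent.
  set l : ℝ := (1 - r ^ 2 / (r + t) ^ 2) / 2 with hl
  have hl0 : 0 ≤ l := by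
    have : r ^ 2 / (r + t) ^ 2 ≤ 1 := by
      rw [div_le_one (by positivity)]; gcongr; linarith
    rw [hl]; linarith
  have hl2 : l < 1 / 2 := by
    have : 0 < r ^ 2 / (r + t) ^ 2 := by positivity
    rw [hl]; linarith
  have h := pi_chernoff (n := n) (gaussianReal 0 1) (fun x => l * x ^ 2)
    (integrable_exp_mul_sq_gaussian hl2) (l * (r + t) ^ 2)
  refine (measureReal_mono ?_).trans (h.trans ?_)
  · intro y hy
    simp only [Set.mem_ofPred_eq, ← Finset.mul_sum] at hy ⊢
    exact mul_le_mul_of_nonneg_left hy.le hl0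
  rw [integral_exp_mul_sq_gaussian hl2]
  have h1 : 1 - 2 * l = (r / (r + t)) ^ 2 := by rw [hl, div_pow]; ring
  have h2 : l * (r + t) ^ 2 = r * t + t ^ 2 / 2 := by
    rw [hl]; field_simp; ring
  rw [h1, Real.sqrt_sq (by positivity), h2, inv_div]
  have h3 : (r + t) / r ≤ Real.exp (t / r) := by
    rw [add_div, div_self hr.ne', add_comm]; exact Real.add_one_le_exp _
  calc Real.exp (-(r * t + t ^ 2 / 2)) * ((r + t) / r) ^ n
      ≤ Real.exp (-(r * t + t ^ 2 / 2)) * Real.exp (t / r) ^ n := by gcongr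
    _ = Real.exp (-t ^ 2 / 2) := by
      rw [← Real.exp_nat_mul, ← Real.exp_add, ← hrn]
      congr 1
      field_simp
      ring

/-- Two-sided concentration of a chi-square variable around its mean. -/
theorem stdGaussianPi_abs_sum_sq_sub {n : ℕ} {δ : ℝ} (hδ : 0 < δ) (hδ1 : δ ≤ 1) :
    (stdGaussianPi n).real {y | δ * n < |∑ i, y i ^ 2 - n|}
      ≤ 2 * Real.exp (-(δ ^ 2 * n / 18)) := by
  have hrn : √(n : ℝ) ^ 2 = n := Real.sq_sqrt (by positivity)
  -- For `δ ≤ 1` one has `(√n + δ √n / 3) ^ 2 ≤ (1 + δ) n`; the lower tail uses the exponent `-δ / 2`.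
  have hup := stdGaussianPi_sum_sq_gt (n := n) (t := δ * √n / 3) (by positivity)
  have hlow := pi_chernoff (n := n) (gaussianReal 0 1) (fun x => (-(δ / 2)) * x ^ 2)
    (integrable_exp_mul_sq_gaussian (by linarith)) (-(δ / 2) * ((1 - δ) * n))
  rw [integral_exp_mul_sq_gaussian (by linarith)] at hlow
  have hsub : {y : Fin n → ℝ | δ * n < |∑ i, y i ^ 2 - n|} ⊆
      {y | (√n + δ * √n / 3) ^ 2 < ∑ i, y i ^ 2} ∪
      {y | -(δ / 2) * ((1 - δ) * n) ≤ ∑ i, (-(δ / 2)) * y i ^ 2} := by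
    intro y hy
    simp only [Set.mem_ofPred_eq, Set.mem_union, ← Finset.mul_sum] at hy ⊢
    rcases lt_abs.mp hy with h | h
    · left
      have : (√n + δ * √n / 3) ^ 2 = n * (1 + δ / 3) ^ 2 := by
        linear_combination (1 + δ / 3) ^ 2 * hrn
      rw [this]
      have : n * (1 + δ / 3) ^ 2 ≤ n * (1 + δ) := by gcongr; nlinarith
      linarith
    · right
      nlinarith
  have e1 : Real.exp (-(δ * √n / 3) ^ 2 / 2) = Real.exp (-(δ ^ 2 * n / 18)) := by
    congr 1; linear_combination (-δ ^ 2 / 18) * hrn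
  have e2 : Real.exp (-(-(δ / 2) * ((1 - δ) * n))) * (√(1 - 2 * -(δ / 2)))⁻¹ ^ n
      ≤ Real.exp (-(δ ^ 2 * n / 18)) := by
    have hlog : δ - δ ^ 2 / 2 ≤ Real.log (1 + δ) := by
      refine le_trans ?_ (Real.le_log_one_add_of_nonneg hδ.le)
      rw [le_div_iff₀ (by linarith)]
      nlinarith [pow_pos hδ 3]
    have hs : (√(1 - 2 * -(δ / 2)))⁻¹ = Real.exp (-(Real.log (1 + δ) / 2)) := by
      rw [Real.exp_neg, ← Real.log_sqrt (by linarith), Real.exp_log (by positivity)]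
      ring_nf
    rw [hs, ← Real.exp_nat_mul, ← Real.exp_add, Real.exp_le_exp]
    have : (0 : ℝ) ≤ n := by positivity
    nlinarith [mul_le_mul_of_nonneg_left hlog this, mul_nonneg this (sq_nonneg δ)]
  calc _ ≤ _ := measureReal_mono hsub
    _ ≤ _ := measureReal_union_le _ _
    _ ≤ _ := by
      rw [two_mul]
      exact add_le_add (hup.trans_eq e1) (hlow.trans e2)

/-- A tail bound for one coordinate. The factor `3 / 8` instead of `1 / 2` is enough for union
bounds at level `2 * √(log N)`. -/
theorem stdGaussianPi_abs_gt {n : ℕ} (i : Fin n) {t : ℝ} (ht : 0 ≤ t) :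
    (stdGaussianPi n).real {y | t < |y i|} ≤ 2 * Real.exp (-(3 / 8 * t ^ 2)) := by
  have h := measure_ge_le_exp_mul_mgf (μ := gaussianReal 0 1)
    (X := fun x => (3 / 8 : ℝ) * x ^ 2) (t := 1) (3 / 8 * t ^ 2) zero_le_one
    (by simpa using integrable_exp_mul_sq_gaussian (l := 3 / 8) (by norm_num))
  rw [mgf] at h
  simp only [one_mul] at h
  rw [integral_exp_three_eighths_mul_sq_gaussian, mul_comm _ (2 : ℝ), neg_one_mul] at h
  have hmp := measurePreserving_eval (fun _ : Fin n => gaussianReal 0 1) i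
  have hms : MeasurableSet {x : ℝ | t < |x|} := measurableSet_lt (by fun_prop) (by fun_prop)
  have : (stdGaussianPi n).real {y | t < |y i|} = (gaussianReal 0 1).real {x | t < |x|} := by
    rw [measureReal_def, measureReal_def, ← hmp.measure_preimage hms.nullMeasurableSet]
    rfl
  rw [this]
  refine (measureReal_mono ?_).trans h
  intro x hx
  simp only [Set.mem_ofPred_eq] at hx ⊢
  have : t ^ 2 ≤ x ^ 2 := by rw [← sq_abs x]; gcongr
  linarith

/-! ### Third moments of Gaussian samples -/

/-- The sum of the cubes of the entries of size at most `M` is a sum of bounded variables. -/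
theorem stdGaussianPi_sum_small_cube {n : ℕ} {M : ℝ} (hM : 0 < M) :
    (stdGaussianPi n).real {y | (2 * (∫ x, |x| ^ 3 ∂(gaussianReal 0 1)) + 1) * n
        ≤ ∑ i, if |y i| ≤ M then |y i| ^ 3 else 0} ≤ Real.exp (-(n / M ^ 3)) := by
  set c := ∫ x, |x| ^ 3 ∂(gaussianReal 0 1) with hc
  set φ : ℝ → ℝ := fun x => (if |x| ≤ M then |x| ^ 3 else 0) / M ^ 3 with hφ
  have hms : MeasurableSet {x : ℝ | |x| ≤ M} := measurableSet_le (by fun_prop) (by fun_prop)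
  have hφm : Measurable φ := (Measurable.ite hms (by fun_prop) (by fun_prop)).div_const _
  have hM3 : 0 < M ^ 3 := by positivity
  have hφ0 : ∀ x, 0 ≤ φ x := fun x => by simp only [hφ]; split_ifs <;> positivity
  have hφ1 : ∀ x, φ x ≤ 1 := fun x => by
    simp only [hφ]
    rw [div_le_one hM3]
    split_ifs with h
    · gcongr
    · positivity
  have hφc : ∀ x, φ x ≤ |x| ^ 3 / M ^ 3 := fun x => by
    simp only [hφ]
    gcongr
    split_ifs
    · exact le_rfl
    · positivity
  have hcub : Integrable (fun x : ℝ => |x| ^ 3) (gaussianReal 0 1) := by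
    have := (memLp_id_gaussianReal (μ := 0) (v := 1) 3).integrable_norm_pow (p := 3) (by norm_num)
    simpa using this
  have hexp : ∀ x, Real.exp (φ x) ≤ 1 + 2 * (|x| ^ 3 / M ^ 3) := fun x => by
    have h1 := Real.abs_exp_sub_one_sub_id_le (x := φ x) (by
      rw [abs_of_nonneg (hφ0 x)]; exact hφ1 x)
    have h2 := le_of_abs_le h1
    nlinarith [hφ0 x, hφ1 x, hφc x]
  have hint : Integrable (fun x => Real.exp (φ x)) (gaussianReal 0 1) := by
    refine Integrable.of_bound (by fun_prop) (Real.exp 1) (ae_of_all _ fun x => ?_)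
    rw [Real.norm_eq_abs, Real.abs_exp]
    exact Real.exp_le_exp.mpr (hφ1 x)
  have hmgf : ∫ x, Real.exp (φ x) ∂(gaussianReal 0 1) ≤ Real.exp (2 * (c / M ^ 3)) := by
    have hi2 := ((hcub.div_const (M ^ 3)).const_mul 2)
    calc _ ≤ ∫ x, (1 + 2 * (|x| ^ 3 / M ^ 3)) ∂(gaussianReal 0 1) :=
          integral_mono hint ((integrable_const 1).add hi2) hexp
      _ = 1 + 2 * (c / M ^ 3) := by
          rw [integral_add (integrable_const 1) hi2, integral_const_mul, integral_div]
          simp [hc]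
      _ ≤ _ := by rw [add_comm]; exact Real.add_one_le_exp _
  have h := pi_chernoff (n := n) (gaussianReal 0 1) φ hint ((2 * c + 1) * n / M ^ 3)
  refine (measureReal_mono ?_).trans (h.trans ?_)
  · intro y hy
    simp only [Set.mem_ofPred_eq, hφ, ← Finset.sum_div] at hy ⊢
    gcongr
  · calc _ ≤ Real.exp (-((2 * c + 1) * n / M ^ 3)) * Real.exp (2 * (c / M ^ 3)) ^ n := by
          gcongr
      _ = _ := by
          rw [← Real.exp_nat_mul, ← Real.exp_add]
          congr 1
          ring

/-- The sum of the squares of the entries larger than `M` has an exponential moment that is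
close to `1` for large `M`. -/
theorem stdGaussianPi_sum_large_sq {n : ℕ} {M : ℝ} (hM : 0 ≤ M) (r : ℝ) :
    (stdGaussianPi n).real {y | r ≤ ∑ i, if |y i| ≤ M then 0 else y i ^ 2}
      ≤ Real.exp (-(r / 8)) * Real.exp (2 * Real.exp (-(M ^ 2 / 4)) * n) := by
  set φ : ℝ → ℝ := fun x => (if |x| ≤ M then 0 else x ^ 2) / 8 with hφ
  have hms : MeasurableSet {x : ℝ | |x| ≤ M} := measurableSet_le (by fun_prop) (by fun_prop)
  have hφm : Measurable φ := (Measurable.ite hms (by fun_prop) (by fun_prop)).div_const _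
  -- On `|x| > M` one has `x ^ 2 / 8 ≤ - M ^ 2 / 4 + 3 / 8 * x ^ 2`.
  have hexp : ∀ x, Real.exp (φ x)
      ≤ 1 + Real.exp (-(M ^ 2 / 4)) * Real.exp (3 / 8 * x ^ 2) := fun x => by
    rw [← Real.exp_add]
    simp only [hφ]
    split_ifs with h
    · simp only [zero_div, Real.exp_zero]
      linarith [Real.exp_pos (-(M ^ 2 / 4) + 3 / 8 * x ^ 2)]
    · have h2 : M ^ 2 ≤ x ^ 2 := by
        rw [← sq_abs x]; gcongr; exact (not_le.mp h).le
      have : Real.exp (x ^ 2 / 8) ≤ Real.exp (-(M ^ 2 / 4) + 3 / 8 * x ^ 2) :=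
        Real.exp_le_exp.mpr (by linarith)
      linarith
  have hint3 := integrable_exp_mul_sq_gaussian (l := 3 / 8) (by norm_num)
  have hdom := (integrable_const (μ := gaussianReal 0 1) (1 : ℝ)).add
    (hint3.const_mul (Real.exp (-(M ^ 2 / 4))))
  have hint : Integrable (fun x => Real.exp (φ x)) (gaussianReal 0 1) := by
    refine hdom.mono' (by fun_prop) (ae_of_all _ fun x => ?_)
    rw [Real.norm_eq_abs, Real.abs_exp]
    exact hexp x
  have hmgf : ∫ x, Real.exp (φ x) ∂(gaussianReal 0 1)
      ≤ Real.exp (2 * Real.exp (-(M ^ 2 / 4))) := by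
    calc _ ≤ ∫ x, (1 + Real.exp (-(M ^ 2 / 4)) * Real.exp (3 / 8 * x ^ 2))
            ∂(gaussianReal 0 1) := integral_mono hint hdom hexp
      _ = 1 + 2 * Real.exp (-(M ^ 2 / 4)) := by
          rw [integral_add (integrable_const 1) (hint3.const_mul _), integral_const_mul,
            integral_exp_three_eighths_mul_sq_gaussian]
          simp [mul_comm]
      _ ≤ _ := by rw [add_comm]; exact Real.add_one_le_exp _
  have h := pi_chernoff (n := n) (gaussianReal 0 1) φ hint (r / 8)
  refine (measureReal_mono ?_).trans (h.trans ?_)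
  · intro y hy
    simp only [Set.mem_ofPred_eq, hφ, ← Finset.sum_div] at hy ⊢
    gcongr
  · rw [mul_comm _ (n : ℝ), Real.exp_nat_mul]
    gcongr

theorem sum_pow_three_le {ι : Type*} (s : Finset ι) (z : ι → ℝ) {R : ℝ}
    (hR : 0 ≤ R) (h : ∑ i ∈ s, z i ^ 2 ≤ R ^ 2) : ∑ i ∈ s, z i ^ 3 ≤ R ^ 3 := by
  have hle : ∀ i ∈ s, z i ≤ R := fun i hi =>
    le_of_sq_le_sq ((Finset.single_le_sum (f := fun i => z i ^ 2)
      (fun i _ => sq_nonneg _) hi).trans h) hR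
  calc ∑ i ∈ s, z i ^ 3 ≤ ∑ i ∈ s, R * z i ^ 2 := Finset.sum_le_sum fun i hi => by
        rw [pow_succ']; gcongr; exact hle i hi
    _ ≤ R * R ^ 2 := by rw [← Finset.mul_sum]; gcongr
    _ = R ^ 3 := by ring

/-- A large deviation bound for the third absolute moment of a Gaussian sample at the speed
`n ^ (2 / 3)`. The constant `A` is universal. -/
theorem exists_stdGaussianPi_sum_cube : ∃ A : ℝ, 0 < A ∧ ∀ᶠ n : ℕ in atTop,
    (stdGaussianPi n).real {y | A * n < ∑ i, |y i| ^ 3}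
      ≤ 4 * Real.exp (-((n : ℝ) ^ (2 / 3 : ℝ) / 8)) := by
  set c := ∫ x, |x| ^ 3 ∂(gaussianReal 0 1) with hc
  have hc0 : 0 ≤ c := integral_nonneg fun x => by positivity
  refine ⟨2 * c + 2, by positivity, ?_⟩
  -- The truncation level is `M = n ^ (1 / 9)`.
  have hlim : Tendsto (fun n : ℕ => 2 * Real.exp (-(((n : ℝ) ^ (1 / 9 : ℝ)) ^ 2 / 4)) * n)
      atTop (𝓝 0) := by
    have h1 : Tendsto (fun x : ℝ => x ^ (9 / 2 : ℝ) * Real.exp (-(1 / 4) * x)) atTop (𝓝 0) :=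
      tendsto_rpow_mul_exp_neg_mul_atTop_nhds_zero _ _ (by norm_num)
    have h2 : Tendsto (fun n : ℕ => ((n : ℝ) ^ (2 / 9 : ℝ))) atTop atTop :=
      (tendsto_rpow_atTop (by norm_num)).comp tendsto_natCast_atTop_atTop
    have h3 := (h1.comp h2).const_mul 2
    rw [mul_zero] at h3
    refine h3.congr fun n => ?_
    have hn : (0 : ℝ) ≤ n := by positivity
    simp only [Function.comp]
    rw [← Real.rpow_mul hn, ← Real.rpow_natCast, ← Real.rpow_mul hn]
    norm_num
    ring_nf
  filter_upwards [hlim.eventually (gt_mem_nhds one_pos), eventually_ge_atTop 1] with n hn hn1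
  have hnpos : (0 : ℝ) < n := by exact_mod_cast hn1
  set M := (n : ℝ) ^ (1 / 9 : ℝ) with hM
  set R := (n : ℝ) ^ (1 / 3 : ℝ) with hR
  have hM0 : 0 < M := by positivity
  have hR0 : 0 < R := by positivity
  have hMR : M ^ 3 = R := by
    rw [hM, hR, ← Real.rpow_natCast, ← Real.rpow_mul hnpos.le]; norm_num
  have hRn : R ^ 3 = n := by
    rw [hR, ← Real.rpow_natCast, ← Real.rpow_mul hnpos.le]; norm_num
  have hR2 : (n : ℝ) ^ (2 / 3 : ℝ) = R ^ 2 := by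
    rw [hR, ← Real.rpow_natCast, ← Real.rpow_mul hnpos.le]; norm_num
  rw [hR2]
  have h1 := stdGaussianPi_sum_small_cube (n := n) hM0
  have h2 := stdGaussianPi_sum_large_sq (n := n) hM0.le (R ^ 2)
  rw [← hc] at h1
  have hsub : {y : Fin n → ℝ | (2 * c + 2) * n < ∑ i, |y i| ^ 3} ⊆
      {y | (2 * c + 1) * n ≤ ∑ i, if |y i| ≤ M then |y i| ^ 3 else 0} ∪
      {y | R ^ 2 ≤ ∑ i, if |y i| ≤ M then 0 else y i ^ 2} := by
    intro y hy
    by_contra hcon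
    simp only [Set.mem_union, Set.mem_ofPred_eq, not_or, not_le] at hy hcon
    obtain ⟨ha, hb⟩ := hcon
    have hb' := sum_pow_three_le Finset.univ (fun i => if |y i| ≤ M then 0 else |y i|)
      hR0.le (by
        refine (Finset.sum_le_sum fun i _ => ?_).trans hb.le
        split_ifs <;> simp)
    rw [hRn] at hb'
    have hsplit : ∑ i, |y i| ^ 3 = (∑ i, if |y i| ≤ M then |y i| ^ 3 else 0)
        + ∑ i, (if |y i| ≤ M then 0 else |y i|) ^ 3 := by
      rw [← Finset.sum_add_distrib]
      refine Finset.sum_congr rfl fun i _ => ?_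
      split_ifs <;> simp
    linarith
  have e1 : Real.exp (-(n / M ^ 3)) ≤ Real.exp (-(R ^ 2 / 8)) := by
    rw [hMR, ← hRn, Real.exp_le_exp, show R ^ 3 / R = R ^ 2 by field_simp]
    linarith [sq_nonneg R]
  have e2 : Real.exp (2 * Real.exp (-(M ^ 2 / 4)) * n) ≤ 3 :=
    (Real.exp_le_exp.mpr hn.le).trans (by linarith [Real.exp_one_lt_d9])
  calc _ ≤ _ := measureReal_mono hsub
    _ ≤ _ := measureReal_union_le _ _
    _ ≤ Real.exp (-(R ^ 2 / 8)) + Real.exp (-(R ^ 2 / 8)) * 3 := by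
      refine add_le_add (h1.trans e1) (h2.trans ?_)
      gcongr
    _ = _ := by ring

/-! ### Convergence of probabilities to one -/

section WithProb

variable {Ω : ℕ → Type*} [∀ n, MeasurableSpace (Ω n)] {P : ∀ n, Measure (Ω n)}
  [∀ n, IsProbabilityMeasure (P n)] {A B : ∀ n, Ω n → Prop}

/-- Convergence in terms of the outer probability of the complement. -/
theorem withProbTendingToOne_iff :
    WithProbTendingToOne P A ↔ Tendsto (fun n => (P n).real {ω | ¬ A n ω}) atTop (𝓝 0) := by
  constructor
  · rintro ⟨E, hE, hEA, hlim⟩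
    have h1 : Tendsto (fun n => 1 - (P n).real (E n)) atTop (𝓝 0) := by
      have := ((ENNReal.tendsto_toReal ENNReal.one_ne_top).comp hlim).const_sub 1
      simpa [measureReal_def] using this
    refine squeeze_zero (fun n => measureReal_nonneg) (fun n => ?_) h1
    rw [← probReal_compl_eq_one_sub (hE n)]
    exact measureReal_mono fun ω hω hωE => hω (hEA n ω hωE)
  · intro h
    refine ⟨fun n => (toMeasurable (P n) {ω | ¬ A n ω})ᶜ,
      fun n => (measurableSet_toMeasurable _ _).compl, fun n ω hω => ?_, ?_⟩
    · by_contra hA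
      exact hω (subset_toMeasurable _ _ hA)
    · have h1 : Tendsto (fun n => 1 - (P n) {ω | ¬ A n ω}) atTop (𝓝 (1 - 0)) := by
        refine ENNReal.Tendsto.sub tendsto_const_nhds ?_ (by simp)
        have := ENNReal.tendsto_ofReal h
        simpa [ofReal_measureReal] using this
      rw [tsub_zero] at h1
      refine h1.congr fun n => ?_
      rw [prob_compl_eq_one_sub (measurableSet_toMeasurable _ _), measure_toMeasurable]

theorem WithProbTendingToOne.and (hA : WithProbTendingToOne P A)
    (hB : WithProbTendingToOne P B) : WithProbTendingToOne P fun n ω => A n ω ∧ B n ω := by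
  rw [withProbTendingToOne_iff] at *
  have h := hA.add hB
  rw [add_zero] at h
  refine squeeze_zero (fun n => measureReal_nonneg) (fun n => ?_) h
  refine (measureReal_mono fun ω hω => ?_).trans (measureReal_union_le _ _)
  simp only [Set.mem_ofPred_eq, Set.mem_union] at hω ⊢
  tauto

theorem WithProbTendingToOne.mono (hA : WithProbTendingToOne P A)
    (h : ∀ᶠ n in atTop, ∀ ω, A n ω → B n ω) : WithProbTendingToOne P B := by
  rw [withProbTendingToOne_iff] at *
  refine squeeze_zero' (Eventually.of_forall fun n => measureReal_nonneg) ?_ hA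
  filter_upwards [h] with n hn
  exact measureReal_mono fun ω hω hA => hω (hn ω hA)

theorem withProbTendingToOne_of_le {ε : ℕ → ℝ} (hε : Tendsto ε atTop (𝓝 0))
    (h : ∀ᶠ n in atTop, (P n).real {ω | ¬ A n ω} ≤ ε n) : WithProbTendingToOne P A :=
  withProbTendingToOne_iff.mpr
    (squeeze_zero' (Eventually.of_forall fun _ => measureReal_nonneg) h hε)

end WithProb

/-- The union bound, with one bound for all events. -/
theorem measureReal_exists_le {Ω ι : Type*} [MeasurableSpace Ω] {μ : Measure Ω} [Fintype ι]
    {B : ι → Ω → Prop} {ε : ℝ} (h : ∀ i, μ.real {ω | B i ω} ≤ ε) :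
    μ.real {ω | ∃ i, B i ω} ≤ Fintype.card ι * ε := by
  have e : {ω | ∃ i, B i ω} = ⋃ i, {ω | B i ω} := by ext; simp
  rw [e]
  refine (measureReal_iUnion_fintype_le _).trans ((Finset.sum_le_sum fun i _ => h i).trans ?_)
  simp

/-! ### Images of unit vectors under a Gaussian matrix -/

/-- `X` is a random `n × p` matrix for which `X u` is a standard Gaussian vector for every
unit vector `u`; this is all that is used about a matrix with i.i.d. `N(0, 1)` entries. -/
def IsIsotropicGaussian {Ω : Type*} [MeasurableSpace Ω] {n p : ℕ} (P : Measure Ω)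
    (X : Ω → Matrix (Fin n) (Fin p) ℝ) : Prop :=
  ∀ u : EuclideanSpace ℝ (Fin p), ‖u‖ = 1 → HasLaw (fun ω => X ω *ᵥ u.ofLp) (stdGaussianPi n) P

theorem isIsotropicGaussian_of_iid {Ω : Type*} [MeasurableSpace Ω] {n p : ℕ} {P : Measure Ω}
    [IsProbabilityMeasure P] {X : Ω → Matrix (Fin n) (Fin p) ℝ}
    (hlaw : ∀ i j, HasLaw (fun ω => X ω i j) (gaussianReal 0 1) P)
    (hindep : iIndepFun (fun (ij : Fin n × Fin p) ω => X ω ij.1 ij.2) P) :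
    IsIsotropicGaussian P X := by
  intro u hu
  have hm : ∀ i j, AEMeasurable (fun ω => X ω i j) P := fun i j => (hlaw i j).aemeasurable
  have hmv : AEMeasurable (fun ω => X ω *ᵥ u.ofLp) P := by
    refine aemeasurable_pi_lambda _ fun i => ?_
    simp only [Matrix.mulVec, dotProduct]
    exact Finset.aemeasurable_fun_sum _ fun j _ => (hm i j).mul_const _
  refine ⟨hmv, ?_⟩
  have := Measure.isProbabilityMeasure_map hmv
  refine charFun_eq_pi_iff.mp fun t => ?_
  -- `⟪t, X u⟫` is the sum of the independent variables `t i * u j * X i j`.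
  have hc : iIndepFun (fun (ij : Fin n × Fin p) ω => (t ij.1 * u ij.2) * X ω ij.1 ij.2) P :=
    hindep.comp (fun (ij : Fin n × Fin p) x => (t ij.1 * u ij.2) * x)
      (fun _ => measurable_const_mul _)
  have hsum := congrFun (hc.charFun_map_fun_sum_eq_prod
    fun (ij : Fin n × Fin p) => (hm ij.1 ij.2).const_mul _) 1
  have e1 : charFun ((P.map (fun ω => X ω *ᵥ u.ofLp)).map (WithLp.toLp 2)) t
      = charFun (P.map fun ω => ∑ ij : Fin n × Fin p, (t ij.1 * u ij.2) * X ω ij.1 ij.2) 1 := by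
    rw [AEMeasurable.map_map_of_aemeasurable (by fun_prop) hmv]
    simp only [charFun_apply]
    rw [integral_map (by fun_prop) (by fun_prop),
      integral_map (Finset.aemeasurable_fun_sum _
        fun (ij : Fin n × Fin p) _ => (hm ij.1 ij.2).const_mul _)
        (by fun_prop)]
    congr 1
    ext ω
    congr 3
    simp only [Function.comp, PiLp.inner_apply, Matrix.mulVec, dotProduct, RCLike.inner_apply,
      conj_trivial, Fintype.sum_prod_type, one_mul, Finset.mul_sum]
    refine Finset.sum_congr rfl fun i _ => Finset.sum_congr rfl fun j _ => by ring
  rw [e1, hsum, Finset.prod_apply]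
  have e2 : ∀ ij : Fin n × Fin p,
      charFun (P.map fun ω => (t ij.1 * u ij.2) * X ω ij.1 ij.2) 1
        = Complex.exp (-((t ij.1 : ℂ) ^ 2 / 2) * ((u ij.2 ^ 2 : ℝ) : ℂ)) := fun ij => by
    rw [(gaussianReal_const_mul (hlaw ij.1 ij.2) _).map_eq, charFun_gaussianReal]
    congr 1
    push_cast
    simp
    ring
  have hu2 : ∑ j, u j ^ 2 = 1 := by
    have := EuclideanSpace.real_norm_sq_eq u
    rw [hu] at this; linarith
  simp only [e2]
  rw [Fintype.prod_prod_type]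
  refine Finset.prod_congr rfl fun i _ => ?_
  dsimp only
  rw [← Complex.exp_sum, ← Finset.mul_sum, ← Complex.ofReal_sum, hu2, charFun_gaussianReal]
  congr 1
  simp

section Isotropic

variable {Ω : Type*} [MeasurableSpace Ω] {n p : ℕ} {P : Measure Ω}
  {X : Ω → Matrix (Fin n) (Fin p) ℝ}

theorem IsIsotropicGaussian.measureReal_eq (hX : IsIsotropicGaussian P X)
    {u : EuclideanSpace ℝ (Fin p)} (hu : ‖u‖ = 1) {q : (Fin n → ℝ) → Prop}
    (hq : MeasurableSet {y | q y}) :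
    P.real {ω | q (X ω *ᵥ u.ofLp)} = (stdGaussianPi n).real {y | q y} :=
  (hX u hu).measureReal_eq hq

end Isotropic

/-! ### Inverses of diagonally dominant matrices -/

/-- A matrix whose difference from `a • 1` has maximal absolute row sum at most `a / 2` is
invertible: for a row of `H = G⁻¹` with absolute sum `r`, the identity
`a • H = 1 - H * (G - a • 1)` yields `a * r ≤ 1 + r * a / 2`. -/
theorem isUnit_and_inftyNorm_inv_le {ι : Type*} [Fintype ι] [DecidableEq ι] (G : Matrix ι ι ℝ)
    {a : ℝ} (ha : 0 < a) (h : ∀ i, ∑ j, |(G - a • (1 : Matrix ι ι ℝ)) i j| ≤ a / 2) :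
    IsUnit G ∧ inftyNorm G⁻¹ ≤ 2 / a := by
  have hdet : G.det ≠ 0 := by
    refine det_ne_zero_of_sum_row_lt_diag fun k => ?_
    have hk := h k
    rw [← Finset.add_sum_erase _ _ (Finset.mem_univ k)] at hk
    have e : ∑ j ∈ Finset.univ.erase k, |(G - a • (1 : Matrix ι ι ℝ)) k j|
        = ∑ j ∈ Finset.univ.erase k, ‖G k j‖ := by
      refine Finset.sum_congr rfl fun j hj => ?_
      simp [Matrix.one_apply_ne (Finset.ne_of_mem_erase hj).symm]
    rw [e] at hk
    simp only [Matrix.sub_apply, Matrix.smul_apply, Matrix.one_apply_eq, smul_eq_mul,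
      mul_one] at hk
    have := neg_abs_le (G k k - a)
    have := le_abs_self (G k k)
    rw [Real.norm_eq_abs]
    linarith
  have hU : IsUnit G.det := isUnit_iff_ne_zero.mpr hdet
  refine ⟨(Matrix.isUnit_iff_isUnit_det G).mpr hU, Real.iSup_le (fun i => ?_) (by positivity)⟩
  have hid : a • G⁻¹ = 1 - G⁻¹ * (G - a • (1 : Matrix ι ι ℝ)) := by
    rw [mul_sub, Matrix.nonsing_inv_mul _ hU]; simp
  have hrow : ∀ j, a * |G⁻¹ i j|
      ≤ |(1 : Matrix ι ι ℝ) i j|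
        + ∑ k, |G⁻¹ i k| * |(G - a • (1 : Matrix ι ι ℝ)) k j| := fun j => by
    have := congrFun (congrFun hid i) j
    rw [Matrix.smul_apply, smul_eq_mul, Matrix.sub_apply, Matrix.mul_apply] at this
    rw [← abs_of_pos ha, ← abs_mul, abs_of_pos ha, this]
    refine (abs_sub _ _).trans (add_le_add le_rfl ?_)
    refine (Finset.abs_sum_le_sum_abs _ _).trans_eq ?_
    simp only [abs_mul]
  have hsum := Finset.sum_le_sum fun j (_ : j ∈ Finset.univ) => hrow j
  rw [← Finset.mul_sum, Finset.sum_add_distrib, Finset.sum_comm] at hsum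
  have h1 : ∑ j, |(1 : Matrix ι ι ℝ) i j| = 1 := by
    simp [Matrix.one_apply, apply_ite abs]
  have h2 : ∑ k, ∑ j, |G⁻¹ i k| * |(G - a • (1 : Matrix ι ι ℝ)) k j|
      ≤ ∑ k, |G⁻¹ i k| * (a / 2) := by
    refine Finset.sum_le_sum fun k _ => ?_
    rw [← Finset.mul_sum]
    gcongr
    exact h k
  rw [← Finset.sum_mul] at h2
  rw [le_div_iff₀ ha]
  rw [h1] at hsum
  nlinarith

/-! ### A net of the sparse unit vectors -/

section Net

variable {n p m : ℕ}

instance : Fact ((1 : ENNReal) ≤ 3) := ⟨by norm_num⟩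

/-- The vector with `m` (not necessarily distinct) marked coordinates and coordinate values in
the grid `{k / p : |k| ≤ p}`. These vectors form a net of the `m`-sparse unit vectors. -/
noncomputable def gridVec (c : Fin m → Fin p × Finset.Icc (-(p : ℤ)) p) :
    EuclideanSpace ℝ (Fin p) :=
  WithLp.toLp 2 (∑ l, Pi.single (c l).1 (((c l).2 : ℤ) / p : ℝ))

theorem card_grid (m p : ℕ) :
    Fintype.card (Fin m → Fin p × Finset.Icc (-(p : ℤ)) p) = (p * (2 * p + 1)) ^ m := by
  simp only [Fintype.card_fun, Fintype.card_prod, Fintype.card_fin, Fintype.card_coe,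
    Int.card_Icc]
  congr 2
  omega

theorem exists_gridVec_eq_zeroExt (hp : 0 < p) {S : Finset (Fin p)} (hS : S.card ≤ m)
    (k : S → Finset.Icc (-(p : ℤ)) p) :
    ∃ c : Fin m → Fin p × Finset.Icc (-(p : ℤ)) p,
      gridVec c = zeroExt S (WithLp.toLp 2 fun j => ((k j : ℤ) / p : ℝ)) := by
  have hzero : (0 : ℤ) ∈ Finset.Icc (-(p : ℤ)) p := by simp
  have hcard : Fintype.card S ≤ Fintype.card (Fin m) := by simpa using hS
  obtain ⟨e⟩ := Function.Embedding.nonempty_of_card_le hcard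
  refine ⟨Function.extend e (fun j => (j.1, k j)) fun _ => (⟨0, hp⟩, ⟨0, hzero⟩), ?_⟩
  ext j
  simp only [gridVec, zeroExt]
  rw [← Fintype.sum_of_injective e e.injective
    (fun j : S => Pi.single j.1 ((k j : ℤ) / p : ℝ))]
  · rw [Finset.sum_apply]
    split_ifs with hj
    · rw [Finset.sum_eq_single ⟨j, hj⟩]
      · simp
      · intro b _ hb
        exact Pi.single_eq_of_ne (fun h => hb (Subtype.ext h.symm)) _
      · simp
    · refine Finset.sum_eq_zero fun b _ => ?_
      exact Pi.single_eq_of_ne (fun h : j = b.1 => hj (h ▸ b.2)) _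
  · intro l hl
    rw [Function.extend_apply' _ _ _ (by simpa using hl)]
    simp
  · intro i
    rw [e.injective.extend_apply]

theorem norm_zeroExt (S : Finset (Fin p)) (v : EuclideanSpace ℝ S) : ‖zeroExt S v‖ = ‖v‖ := by
  rw [EuclideanSpace.norm_eq, EuclideanSpace.norm_eq]
  congr 1
  rw [← Finset.sum_subset (Finset.subset_univ S), ← Finset.sum_coe_sort S]
  · exact Finset.sum_congr rfl fun j _ => by simp [zeroExt]
  · intro j _ hj
    simp [zeroExt, hj]

theorem mulVec_zeroExt (X : Matrix (Fin n) (Fin p) ℝ) (S : Finset (Fin p))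
    (v : EuclideanSpace ℝ S) : X *ᵥ (zeroExt S v).ofLp = cols X S *ᵥ v.ofLp := by
  ext i
  simp only [Matrix.mulVec, dotProduct]
  rw [← Finset.sum_subset (Finset.subset_univ S), ← Finset.sum_coe_sort S]
  · exact Finset.sum_congr rfl fun j _ => by simp [zeroExt, cols]
  · intro j _ hj
    simp [zeroExt, hj]

/-- Rounding the coordinates of a unit vector to the grid moves it by at most `1 / 2`. -/
theorem exists_grid_near (hp : 0 < p) {S : Finset (Fin p)} {u : EuclideanSpace ℝ S}
    (hu : ‖u‖ = 1) : ∃ k : S → Finset.Icc (-(p : ℤ)) p,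
      ‖u - WithLp.toLp 2 fun j => ((k j : ℤ) / p : ℝ)‖ ≤ 1 / 2 := by
  have hp' : (0 : ℝ) < p := by exact_mod_cast hp
  have hround : ∀ j : S, round (u j * p) ∈ Finset.Icc (-(p : ℤ)) p := fun j => by
    have h1 : |u j| ≤ 1 := by
      have := PiLp.norm_apply_le u j
      rwa [hu, Real.norm_eq_abs] at this
    have h2 := abs_le.mp (abs_sub_round (u j * p))
    have h3 := abs_le.mp h1
    rw [Finset.mem_Icc]
    constructor
    · have : (-(p : ℤ) - 1 : ℝ) < round (u j * p) := by push_cast; nlinarith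
      have : (-(p : ℤ) - 1 : ℤ) < round (u j * p) := by exact_mod_cast this
      omega
    · have : (round (u j * p) : ℝ) < p + 1 := by nlinarith
      have : round (u j * p) < (p : ℤ) + 1 := by exact_mod_cast this
      omega
  refine ⟨fun j => ⟨round (u j * p), hround j⟩, ?_⟩
  rw [EuclideanSpace.norm_eq]
  refine Real.sqrt_le_iff.mpr ⟨by norm_num, ?_⟩
  have hterm : ∀ j : S, ‖(u - WithLp.toLp 2 fun j => ((round (u j * p) : ℤ) / p : ℝ)) j‖ ^ 2
      ≤ (1 / (2 * p)) ^ 2 := fun j => by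
    gcongr
    have h2 := abs_sub_round (u j * p)
    simp only [PiLp.sub_apply, Real.norm_eq_abs]
    rw [show u j - (round (u j * p) : ℝ) / p = (u j * p - round (u j * p)) / p by field_simp,
      abs_div, abs_of_pos hp', div_le_div_iff₀ hp' (by positivity)]
    nlinarith
  refine (Finset.sum_le_sum fun j _ => hterm j).trans ?_
  have hS : (S.card : ℝ) ≤ p := by
    exact_mod_cast (Finset.card_le_univ S).trans_eq (Fintype.card_fin p)
  have hp1 : (1 : ℝ) ≤ p := by exact_mod_cast hp
  simp only [Finset.sum_const, Finset.card_univ, Fintype.card_coe, nsmul_eq_mul]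
  rw [div_pow, one_pow, mul_one_div, div_le_iff₀ (by positivity)]
  nlinarith

/-- A bound for `‖X v‖₃` on the net passes, up to a factor `3`, to all sparse unit vectors: the
maximum `f` over the unit sphere of `ℝ^S` satisfies `f ≤ (3 / 2) * a + f / 2`. -/
theorem norm_cols_mulVec_le_of_grid (hp : 0 < p) (X : Matrix (Fin n) (Fin p) ℝ) {a : ℝ}
    (ha : 0 ≤ a)
    (hnet : ∀ c : Fin m → Fin p × Finset.Icc (-(p : ℤ)) p,
      ‖WithLp.toLp 3 (X *ᵥ (gridVec c).ofLp)‖ ≤ ‖gridVec c‖ * a)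
    {S : Finset (Fin p)} (hS : S.card ≤ m) {u : EuclideanSpace ℝ S} (hu : ‖u‖ = 1) :
    ‖WithLp.toLp 3 (cols X S *ᵥ u.ofLp)‖ ≤ 3 * a := by
  set f : EuclideanSpace ℝ S → ℝ := fun u => ‖WithLp.toLp 3 (cols X S *ᵥ u.ofLp)‖ with hf
  have hcont : Continuous f := by
    refine continuous_norm.comp ((PiLp.continuous_toLp 3 _).comp ?_)
    exact Continuous.matrix_mulVec continuous_const (PiLp.continuous_ofLp 2 _)
  obtain ⟨w, hw, hmax⟩ := (isCompact_sphere (0 : EuclideanSpace ℝ S) 1).exists_isMaxOn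
    ⟨u, by simpa using hu⟩ hcont.continuousOn
  have hw1 : ‖w‖ = 1 := by simpa using hw
  have hsmul : ∀ (r : ℝ) v, f (r • v) = |r| * f v := fun r v => by
    simp only [hf, WithLp.ofLp_smul, Matrix.mulVec_smul, WithLp.toLp_smul, norm_smul,
      Real.norm_eq_abs]
  have hadd : ∀ v v', f (v + v') ≤ f v + f v' := fun v v' => by
    simp only [hf, WithLp.ofLp_add, Matrix.mulVec_add, WithLp.toLp_add]
    exact norm_add_le _ _
  have hhom : ∀ v, f v ≤ ‖v‖ * f w := fun v => by
    rcases eq_or_ne v 0 with rfl | hv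
    · simp [hf]
    · have hv' : ‖v‖ ≠ 0 := norm_ne_zero_iff.mpr hv
      have h1 : f (‖v‖⁻¹ • v) ≤ f w := hmax (by simp [norm_smul, hv'])
      rw [hsmul, abs_inv, abs_norm, inv_mul_le_iff₀ (by positivity)] at h1
      exact h1
  obtain ⟨k, hk⟩ := exists_grid_near hp hw1
  obtain ⟨c, hc⟩ := exists_gridVec_eq_zeroExt hp hS k
  set v : EuclideanSpace ℝ S := WithLp.toLp 2 fun j => ((k j : ℤ) / p : ℝ)
  have hv : ‖v‖ ≤ 3 / 2 := by
    have := norm_sub_norm_le v w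
    rw [norm_sub_rev] at this
    linarith
  have h1 : f v ≤ ‖v‖ * a := by
    have := hnet c
    rwa [hc, mulVec_zeroExt, norm_zeroExt] at this
  have h2 : f w ≤ f v + f (w - v) := by simpa using hadd v (w - v)
  have h3 := hhom (w - v)
  have hw0 : 0 ≤ f w := norm_nonneg _
  have h4 : f u ≤ f w := hmax (by simpa using hu)
  change f u ≤ 3 * a
  nlinarith

theorem norm_toLp_three_pow (y : Fin n → ℝ) :
    ‖WithLp.toLp 3 y‖ ^ 3 = ∑ i, |y i| ^ 3 := by
  rw [PiLp.norm_eq_sum (by norm_num), ← Real.rpow_natCast, ← Real.rpow_mul (by positivity)]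
  norm_num

end Net

/-! ### Deviation bounds for a Gaussian matrix -/

section Events

variable {Ω : Type*} [MeasurableSpace Ω] {n p : ℕ} {P : Measure Ω}
  {X : Ω → Matrix (Fin n) (Fin p) ℝ}

theorem IsIsotropicGaussian.abs_mulVec_gt (hX : IsIsotropicGaussian P X)
    {u : EuclideanSpace ℝ (Fin p)} (hu : ‖u‖ = 1) (i : Fin n) {t : ℝ} (ht : 0 ≤ t) :
    P.real {ω | t < |(X ω *ᵥ u.ofLp) i|} ≤ 2 * Real.exp (-(3 / 8 * t ^ 2)) :=
  (hX.measureReal_eq hu (q := fun y => t < |y i|)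
    (measurableSet_lt (by fun_prop) (by fun_prop))).trans_le (stdGaussianPi_abs_gt i ht)

theorem mulVec_single_one (M : Matrix (Fin n) (Fin p) ℝ) (j : Fin p) :
    M *ᵥ (EuclideanSpace.single j (1 : ℝ)).ofLp = fun i => M i j := by
  ext i
  simp

theorem IsIsotropicGaussian.col_norm_gt (hX : IsIsotropicGaussian P X) (j : Fin p) {t : ℝ}
    (ht : 0 ≤ t) :
    P.real {ω | √n + t < ‖WithLp.toLp 2 fun i => X ω i j‖} ≤ Real.exp (-t ^ 2 / 2) := by
  have h := hX.measureReal_eq (u := EuclideanSpace.single j 1) (by simp)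
    (q := fun y => √n + t < ‖WithLp.toLp 2 y‖)
    (measurableSet_lt (by fun_prop) (by fun_prop))
  simp only [mulVec_single_one] at h
  rw [h]
  refine (measureReal_mono fun y hy => ?_).trans (stdGaussianPi_sum_sq_gt (n := n) ht)
  simp only [Set.mem_ofPred_eq] at hy ⊢
  have h2 := EuclideanSpace.real_norm_sq_eq (WithLp.toLp 2 y)
  simp only at h2
  rw [← h2]
  gcongr

theorem transpose_mul_self_apply (M : Matrix (Fin n) (Fin p) ℝ) (j k : Fin p) :
    (Mᵀ * M) j k = ∑ i, M i j * M i k := by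
  simp [Matrix.mul_apply]

/-- The entries of the Gram matrix concentrate. Off the diagonal, the entry `(j, k)` is half the
difference of the squared norms of the images of the unit vectors `(e_j ± e_k) / √2`. -/
theorem IsIsotropicGaussian.gram_sub_gt [IsProbabilityMeasure P] (hX : IsIsotropicGaussian P X)
    (j k : Fin p) {δ : ℝ} (hδ : 0 < δ) (hδ1 : δ ≤ 1) :
    P.real {ω | δ * n < |((X ω)ᵀ * X ω - (n : ℝ) • (1 : Matrix (Fin p) (Fin p) ℝ)) j k|}
      ≤ 4 * Real.exp (-(δ ^ 2 * n / 18)) := by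
  have hq : MeasurableSet {y : Fin n → ℝ | δ * n < |∑ i, y i ^ 2 - n|} :=
    measurableSet_lt (by fun_prop) (by fun_prop)
  have hu : ∀ u : EuclideanSpace ℝ (Fin p), ‖u‖ = 1 →
      P.real {ω | δ * n < |∑ i, (X ω *ᵥ u.ofLp) i ^ 2 - n|}
        ≤ 2 * Real.exp (-(δ ^ 2 * n / 18)) := fun u hu =>
    (hX.measureReal_eq hu hq).trans_le (stdGaussianPi_abs_sum_sq_sub hδ hδ1)
  rcases eq_or_ne j k with rfl | hjk
  · have h := hu (EuclideanSpace.single j 1) (by simp)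
    simp only [mulVec_single_one] at h
    refine (measureReal_mono fun ω hω => ?_).trans (h.trans ?_)
    · simpa [transpose_mul_self_apply, ← pow_two] using hω
    · linarith [Real.exp_pos (-(δ ^ 2 * n / 18))]
  · have hs2 : (√2 : ℝ)⁻¹ ^ 2 = 1 / 2 := by rw [inv_pow, Real.sq_sqrt (by norm_num)]; norm_num
    have hnorm : ∀ r : ℝ, r ^ 2 = 1 → ‖(√2 : ℝ)⁻¹ • (EuclideanSpace.single j (1 : ℝ)
        + r • EuclideanSpace.single k (1 : ℝ))‖ = 1 := fun r hr => by
      have h1 : ‖(EuclideanSpace.single j (1 : ℝ)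
          + r • EuclideanSpace.single k (1 : ℝ) : EuclideanSpace ℝ (Fin p))‖ ^ 2 = 2 := by
        rw [norm_add_sq_real, inner_smul_right, norm_smul, mul_pow, Real.norm_eq_abs, sq_abs, hr]
        simp [EuclideanSpace.inner_single_left, hjk]
        norm_num
      rw [norm_smul, ← pow_left_inj₀ (by positivity) zero_le_one two_ne_zero, mul_pow, h1]
      rw [Real.norm_eq_abs, sq_abs, hs2]; norm_num
    have hval : ∀ (r : ℝ) ω, ∑ i, (X ω *ᵥ ((√2 : ℝ)⁻¹ • (EuclideanSpace.single j (1 : ℝ)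
        + r • EuclideanSpace.single k (1 : ℝ)) : EuclideanSpace ℝ (Fin p)).ofLp) i ^ 2
        = 1 / 2 * ∑ i, (X ω i j + r * X ω i k) ^ 2 := fun r ω => by
      rw [Finset.mul_sum]
      refine Finset.sum_congr rfl fun i _ => ?_
      rw [WithLp.ofLp_smul, WithLp.ofLp_add, WithLp.ofLp_smul, Matrix.mulVec_smul,
        Matrix.mulVec_add, Matrix.mulVec_smul, mulVec_single_one, mulVec_single_one]
      simp only [Pi.smul_apply, Pi.add_apply, smul_eq_mul]
      rw [mul_pow, hs2]
    have h1 := hu _ (hnorm 1 (by norm_num))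
    have h2 := hu _ (hnorm (-1) (by norm_num))
    simp only [hval] at h1 h2
    refine (measureReal_mono fun ω hω => ?_).trans ((measureReal_union_le _ _).trans
      ((add_le_add h1 h2).trans_eq (by ring)))
    simp only [Set.mem_union, Set.mem_ofPred_eq] at hω ⊢
    by_contra hcon
    rw [not_or, not_lt, not_lt, abs_le, abs_le] at hcon
    have hpol : ∑ i, X ω i j * X ω i k = 1 / 2 * (1 / 2 * ∑ i, (X ω i j + 1 * X ω i k) ^ 2
        - 1 / 2 * ∑ i, (X ω i j + -1 * X ω i k) ^ 2) := by
      rw [← mul_sub, ← Finset.sum_sub_distrib, Finset.mul_sum, Finset.mul_sum]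
      exact Finset.sum_congr rfl fun i _ => by ring
    rw [Matrix.sub_apply, Matrix.smul_apply, Matrix.one_apply_ne hjk, transpose_mul_self_apply,
      smul_zero, sub_zero, hpol] at hω
    refine absurd hω (not_lt.mpr (abs_le.mpr ⟨?_, ?_⟩)) <;> linarith [hcon.1.1, hcon.1.2,
      hcon.2.1, hcon.2.2]

/-- The deviation bound for the third moment, in the homogeneous form for all vectors. -/
theorem IsIsotropicGaussian.norm_three_gt (hX : IsIsotropicGaussian P X)
    (u : EuclideanSpace ℝ (Fin p)) {a : ℝ} (ha : 0 ≤ a) :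
    P.real {ω | ‖u‖ * a < ‖WithLp.toLp 3 (X ω *ᵥ u.ofLp)‖}
      ≤ (stdGaussianPi n).real {y | a ^ 3 < ∑ i, |y i| ^ 3} := by
  rcases eq_or_ne u 0 with rfl | hu
  · simp
  have hu0 : 0 < ‖u‖ := norm_pos_iff.mpr hu
  have h := hX.measureReal_eq (u := ‖u‖⁻¹ • u) (by simp [norm_smul, hu0.ne'])
    (q := fun y => a ^ 3 < ∑ i, |y i| ^ 3) (measurableSet_lt (by fun_prop) (by fun_prop))
  rw [← h]
  have : IsFiniteMeasure P := (hX _ (show ‖‖u‖⁻¹ • u‖ = 1 by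
    simp [norm_smul, hu0.ne'])).isFiniteMeasure
  refine measureReal_mono fun ω hω => ?_
  simp only [Set.mem_ofPred_eq] at hω ⊢
  rw [← norm_toLp_three_pow, WithLp.ofLp_smul, Matrix.mulVec_smul, WithLp.toLp_smul, norm_smul,
    norm_inv, norm_norm]
  gcongr
  rwa [lt_inv_mul_iff₀ hu0]

end Events

/-- The union bound over `N` Gaussian variables at level `2 * √(log N)`. -/
theorem union_bound_eq {N : ℝ} (hN : 1 ≤ N) :
    N * (2 * Real.exp (-(3 / 8 * (2 * √(Real.log N)) ^ 2))) = 2 * N ^ (-(1 / 2) : ℝ) := by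
  have hN0 : 0 < N := by linarith
  rw [mul_pow, Real.sq_sqrt (Real.log_nonneg hN),
    show -(3 / 8 * (2 ^ 2 * Real.log N)) = Real.log N * (-(3 / 2)) by ring,
    ← Real.rpow_def_of_pos hN0, show (-(1 / 2) : ℝ) = 1 + -(3 / 2) by norm_num,
    Real.rpow_add hN0, Real.rpow_one]
  ring

/-! ### Uniform bounds with probability tending to one -/

section Sequences

variable {Ω : ℕ → Type*} [∀ n, MeasurableSpace (Ω n)] {P : ∀ n, Measure (Ω n)}
  [∀ n, IsProbabilityMeasure (P n)] {p : ℕ → ℕ} {X : ∀ n, Ω n → Matrix (Fin n) (Fin (p n)) ℝ}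

theorem withProb_entries (hX : ∀ n, IsIsotropicGaussian (P n) (X n)) (hp : Tendsto p atTop atTop) :
    WithProbTendingToOne P fun n ω => ∀ i j, |X n ω i j| ≤ 2 * √(Real.log (n * p n)) := by
  have hlim : Tendsto (fun n : ℕ => 2 * ((n : ℝ) * p n) ^ (-(1 / 2) : ℝ)) atTop (𝓝 0) := by
    have h1 : Tendsto (fun n : ℕ => (n : ℝ) * p n) atTop atTop :=
      tendsto_natCast_atTop_atTop.atTop_mul_atTop₀ (tendsto_natCast_atTop_atTop.comp hp)
    simpa using ((tendsto_rpow_neg_atTop (y := 1 / 2) (by norm_num)).comp h1).const_mul 2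
  refine withProbTendingToOne_of_le hlim ?_
  filter_upwards [eventually_ge_atTop 1, hp.eventually_ge_atTop 1] with n hn hpn
  have hN : (1 : ℝ) ≤ n * p n := by exact_mod_cast Nat.mul_pos hn hpn
  have hb := measureReal_exists_le (μ := P n)
    (B := fun (ij : Fin n × Fin (p n)) ω => 2 * √(Real.log (n * p n)) < |X n ω ij.1 ij.2|)
    fun ij => by
      have := (hX n).abs_mulVec_gt (u := EuclideanSpace.single ij.2 1) (by simp) ij.1
        (t := 2 * √(Real.log (n * p n))) (by positivity)
      simpa only [mulVec_single_one] using this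
  rw [Fintype.card_prod, Fintype.card_fin, Fintype.card_fin, Nat.cast_mul,
    union_bound_eq hN] at hb
  refine (measureReal_mono fun ω hω => ?_).trans hb
  simpa using hω

theorem withProb_cols (hX : ∀ n, IsIsotropicGaussian (P n) (X n)) (hp : Tendsto p atTop atTop) :
    WithProbTendingToOne P fun n ω => ∀ j, ‖WithLp.toLp 2 fun i => X n ω i j‖
      ≤ √n + 2 * √(Real.log (p n)) := by
  have hlim : Tendsto (fun n : ℕ => ((p n : ℝ))⁻¹) atTop (𝓝 0) :=
    tendsto_inv_atTop_zero.comp (tendsto_natCast_atTop_atTop.comp hp)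
  refine withProbTendingToOne_of_le hlim ?_
  filter_upwards [hp.eventually_ge_atTop 1] with n hpn
  have hN : (1 : ℝ) ≤ p n := by exact_mod_cast hpn
  have hb := measureReal_exists_le (μ := P n) fun j =>
    (hX n).col_norm_gt j (t := 2 * √(Real.log (p n))) (by positivity)
  have e : (p n : ℝ) * Real.exp (-(2 * √(Real.log (p n))) ^ 2 / 2) = (p n : ℝ)⁻¹ := by
    rw [mul_pow, Real.sq_sqrt (Real.log_nonneg hN),
      show -(2 ^ 2 * Real.log (p n)) / 2 = -Real.log (p n) + -Real.log (p n) by ring,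
      Real.exp_add, Real.exp_neg, Real.exp_log (by linarith)]
    field_simp
  rw [Fintype.card_fin, e] at hb
  refine (measureReal_mono fun ω hω => ?_).trans hb
  simpa using hω

theorem withProb_mulVec (hX : ∀ n, IsIsotropicGaussian (P n) (X n))
    (θ : ∀ n, EuclideanSpace ℝ (Fin (p n))) :
    WithProbTendingToOne P fun n ω => ∀ i, |(X n ω *ᵥ (θ n).ofLp) i|
      ≤ 2 * ‖θ n‖ * √(Real.log n) := by
  have hlim : Tendsto (fun n : ℕ => 2 * (n : ℝ) ^ (-(1 / 2) : ℝ)) atTop (𝓝 0) := by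
    simpa using ((tendsto_rpow_neg_atTop (y := 1 / 2) (by norm_num)).comp
      (tendsto_natCast_atTop_atTop (R := ℝ))).const_mul 2
  refine withProbTendingToOne_of_le hlim ?_
  filter_upwards [eventually_ge_atTop 1] with n hn
  have hN : (1 : ℝ) ≤ n := by exact_mod_cast hn
  rcases eq_or_ne (θ n) 0 with h0 | h0
  · simp only [h0]
    simp
    positivity
  have hpos : 0 < ‖θ n‖ := norm_pos_iff.mpr h0
  have hb := measureReal_exists_le (μ := P n) fun i =>
    (hX n).abs_mulVec_gt (u := ‖θ n‖⁻¹ • θ n) (by simp [norm_smul, hpos.ne']) i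
      (t := 2 * √(Real.log n)) (by positivity)
  rw [Fintype.card_fin, union_bound_eq hN] at hb
  refine (measureReal_mono fun ω hω => ?_).trans hb
  simp only [Set.mem_ofPred_eq, not_forall, not_le] at hω ⊢
  obtain ⟨i, hi⟩ := hω
  refine ⟨i, ?_⟩
  rw [WithLp.ofLp_smul, Matrix.mulVec_smul, Pi.smul_apply, smul_eq_mul, abs_mul, abs_inv,
    abs_norm, lt_inv_mul_iff₀ hpos]
  linarith

theorem withProb_gram (hX : ∀ n, IsIsotropicGaussian (P n) (X n)) (hp : Tendsto p atTop atTop)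
    {δ : ℕ → ℝ} (hδ : ∀ᶠ n in atTop, 0 < δ n ∧ δ n ≤ 1 ∧
      3 * Real.log (p n) ≤ δ n ^ 2 * n / 18) :
    WithProbTendingToOne P fun n ω => ∀ j k,
      |((X n ω)ᵀ * X n ω - (n : ℝ) • (1 : Matrix (Fin (p n)) (Fin (p n)) ℝ)) j k| ≤ δ n * n := by
  have hlim : Tendsto (fun n : ℕ => 4 * ((p n : ℝ))⁻¹) atTop (𝓝 0) := by
    simpa using (tendsto_inv_atTop_zero.comp
      ((tendsto_natCast_atTop_atTop (R := ℝ)).comp hp)).const_mul 4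
  refine withProbTendingToOne_of_le hlim ?_
  filter_upwards [hp.eventually_ge_atTop 1, hδ] with n hpn ⟨hδ0, hδ1, hlog⟩
  have hN : (0 : ℝ) < p n := by exact_mod_cast hpn
  have hb := measureReal_exists_le (μ := P n) fun jk : Fin (p n) × Fin (p n) =>
    (hX n).gram_sub_gt jk.1 jk.2 hδ0 hδ1
  have e : Real.exp (-(δ n ^ 2 * n / 18)) ≤ ((p n : ℝ) ^ 3)⁻¹ := by
    rw [← Real.exp_log (x := (p n : ℝ) ^ 3) (by positivity), ← Real.exp_neg, Real.exp_le_exp,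
      Real.log_pow]
    push_cast
    linarith
  rw [Fintype.card_prod, Fintype.card_fin, Nat.cast_mul] at hb
  refine (measureReal_mono fun ω hω => ?_).trans (hb.trans ?_)
  · simpa using hω
  · calc (p n : ℝ) * p n * (4 * Real.exp (-(δ n ^ 2 * n / 18)))
        ≤ (p n : ℝ) * p n * (4 * ((p n : ℝ) ^ 3)⁻¹) := by gcongr
      _ = _ := by field_simp

/-- The bound for the third moments on the whole net, provided that the net has at most
`exp (n ^ (2 / 3) / 16)` elements. -/
theorem withProb_grid (hX : ∀ n, IsIsotropicGaussian (P n) (X n)) {A : ℝ} (hA : 0 < A)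
    (htail : ∀ᶠ n : ℕ in atTop, (stdGaussianPi n).real {y | A * n < ∑ i, |y i| ^ 3}
      ≤ 4 * Real.exp (-((n : ℝ) ^ (2 / 3 : ℝ) / 8)))
    {m : ℕ → ℕ} (hcard : ∀ᶠ n in atTop, ((p n : ℝ) * (2 * p n + 1)) ^ m n
      ≤ Real.exp ((n : ℝ) ^ (2 / 3 : ℝ) / 16)) :
    WithProbTendingToOne P fun n ω =>
      ∀ c : Fin (m n) → Fin (p n) × Finset.Icc (-(p n : ℤ)) (p n),
        ‖WithLp.toLp 3 (X n ω *ᵥ (gridVec c).ofLp)‖ ≤ ‖gridVec c‖ * (A * n) ^ (1 / 3 : ℝ) := by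
  have hlim : Tendsto (fun n : ℕ => 4 * Real.exp (-((n : ℝ) ^ (2 / 3 : ℝ) / 16)))
      atTop (𝓝 0) := by
    have h1 : Tendsto (fun n : ℕ => (n : ℝ) ^ (2 / 3 : ℝ) / 16) atTop atTop :=
      ((tendsto_rpow_atTop (by norm_num)).comp tendsto_natCast_atTop_atTop).atTop_div_const
        (by norm_num)
    simpa using ((Real.tendsto_exp_atBot.comp (tendsto_neg_atTop_atBot.comp h1))).const_mul 4
  refine withProbTendingToOne_of_le hlim ?_
  filter_upwards [htail, hcard] with n ht hc
  have ha3 : ((A * n) ^ (1 / 3 : ℝ)) ^ 3 = A * n := by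
    rw [← Real.rpow_natCast, ← Real.rpow_mul (by positivity)]; norm_num
  have hb := measureReal_exists_le (μ := P n)
    (ε := 4 * Real.exp (-((n : ℝ) ^ (2 / 3 : ℝ) / 8)))
    fun c : Fin (m n) → Fin (p n) × Finset.Icc (-(p n : ℤ)) (p n) =>
      ((hX n).norm_three_gt (gridVec c) (a := (A * n) ^ (1 / 3 : ℝ)) (by positivity)).trans
        (by rwa [ha3])
  rw [card_grid] at hb
  push_cast at hb
  refine (measureReal_mono fun ω hω => ?_).trans (hb.trans ?_)
  · simpa using hω
  · calc _ ≤ Real.exp ((n : ℝ) ^ (2 / 3 : ℝ) / 16)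
          * (4 * Real.exp (-((n : ℝ) ^ (2 / 3 : ℝ) / 8))) := by gcongr
      _ = _ := by
        rw [mul_left_comm, ← Real.exp_add]
        congr 2
        ring

end Sequences

/-! ### Consequences of the growth condition -/

section Asymptotic

variable {s L : ℕ → ℝ}

theorem eventually_mul_sq_mul_le (h : (fun n : ℕ => max (s n ^ 2 * L n)
    ((s n * L n) ^ (3 / 2 : ℝ))) =o[atTop] fun n : ℕ => (n : ℝ)) {K : ℝ} (hK : 0 < K) :
    ∀ᶠ n : ℕ in atTop, K * (s n ^ 2 * L n) ≤ n := by
  filter_upwards [h.bound (inv_pos.mpr hK)] with n hn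
  rw [Real.norm_eq_abs, Real.norm_eq_abs, Nat.abs_cast, ← div_eq_inv_mul,
    le_div_iff₀' hK] at hn
  exact (mul_le_mul_of_nonneg_left ((le_max_left _ _).trans (le_abs_self _)) hK.le).trans hn

theorem eventually_mul_mul_le_rpow (h : (fun n : ℕ => max (s n ^ 2 * L n)
    ((s n * L n) ^ (3 / 2 : ℝ))) =o[atTop] fun n : ℕ => (n : ℝ)) {K : ℝ} (hK : 0 < K)
    (hs : ∀ n, 0 ≤ s n * L n) :
    ∀ᶠ n : ℕ in atTop, K * (s n * L n) ≤ (n : ℝ) ^ (2 / 3 : ℝ) := by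
  have hK' : 0 < K ^ (3 / 2 : ℝ) := by positivity
  filter_upwards [h.bound (inv_pos.mpr hK')] with n hn
  rw [Real.norm_eq_abs, Real.norm_eq_abs, Nat.abs_cast, ← div_eq_inv_mul,
    le_div_iff₀' hK'] at hn
  have h1 := (mul_le_mul_of_nonneg_left ((le_max_right _ _).trans (le_abs_self _)) hK'.le).trans hn
  rw [← Real.mul_rpow hK.le (hs n)] at h1
  have h0 : 0 ≤ K * (s n * L n) := mul_nonneg hK.le (hs n)
  have h2 := Real.rpow_le_rpow (z := (2 / 3 : ℝ)) (by positivity) h1 (by norm_num)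
  rwa [← Real.rpow_mul h0, show (3 / 2 * (2 / 3) : ℝ) = 1 by norm_num, Real.rpow_one] at h2

theorem tendsto_atTop_of_rpow_le {p : ℕ → ℕ} {C : ℝ} (hC : 0 < C)
    (h : ∀ᶠ n : ℕ in atTop, (n : ℝ) ^ C ≤ p n) : Tendsto p atTop atTop :=
  tendsto_natCast_atTop_iff.mp (tendsto_atTop_mono' _ h
    ((tendsto_rpow_atTop hC).comp tendsto_natCast_atTop_atTop))

end Asymptotic

/-! ### The norms, the Gram matrix and the third moments -/

section Sequences

variable {Ω : ℕ → Type*} [∀ n, MeasurableSpace (Ω n)] {P : ∀ n, Measure (Ω n)}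
  [∀ n, IsProbabilityMeasure (P n)] {p : ℕ → ℕ} {X : ∀ n, Ω n → Matrix (Fin n) (Fin (p n)) ℝ}

theorem withProb_norms (hX : ∀ n, IsIsotropicGaussian (P n) (X n)) (hp : Tendsto p atTop atTop)
    (θ₀ : ∀ n, EuclideanSpace ℝ (Fin (p n))) :
    WithProbTendingToOne P (fun n ω =>
      maxNorm (X n ω) ≤ 2 * √(Real.log (n * p n)) ∧
      inftyNorm (cols (X n ω) (supp (θ₀ n)))
        ≤ 2 * (supp (θ₀ n)).card * √(Real.log (n * p n)) ∧
      maxColNorm (X n ω) ≤ √n + 2 * √(Real.log (p n)) ∧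
      (⨆ i, |(X n ω *ᵥ (θ₀ n).ofLp) i|) ≤ 2 * ‖θ₀ n‖ * √(Real.log n)) := by
  refine ((withProb_entries hX hp).and ((withProb_cols hX hp).and
    (withProb_mulVec hX θ₀))).mono (Eventually.of_forall fun n ω h => ?_)
  obtain ⟨h1, h2, h3⟩ := h
  refine ⟨?_, ?_, ?_, ?_⟩
  · exact Real.iSup_le (fun i => Real.iSup_le (fun j => h1 i j) (by positivity)) (by positivity)
  · refine Real.iSup_le (fun i => ?_) (by positivity)
    refine (Finset.sum_le_sum fun j _ => h1 i j.1).trans_eq ?_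
    simp only [Finset.sum_const, Finset.card_univ, Fintype.card_coe, nsmul_eq_mul]
    ring
  · exact Real.iSup_le h2 (by positivity)
  · exact Real.iSup_le h3 (by positivity)

/-- The entries of `XᵀX - n I` are at most `n / (2σ)`, so that every submatrix with at most `σ`
rows and columns has row sums at most `n / 2`. -/
theorem withProb_gram_inv (hX : ∀ n, IsIsotropicGaussian (P n) (X n))
    (hp : Tendsto p atTop atTop) {σ : ℕ → ℝ} (hσ : ∀ᶠ n in atTop, 1 ≤ σ n)
    (hn : ∀ᶠ n : ℕ in atTop, 216 * (σ n ^ 2 * Real.log (p n)) ≤ n) :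
    WithProbTendingToOne P (fun n ω => ∀ S ∈ sparseSupports (p n) (σ n),
      IsUnit ((cols (X n ω) S)ᵀ * cols (X n ω) S) ∧
      inftyNorm ((cols (X n ω) S)ᵀ * cols (X n ω) S)⁻¹ ≤ 2 / n) := by
  refine (withProb_gram hX hp (δ := fun n => 1 / (2 * σ n)) ?_).mono ?_
  · filter_upwards [hσ, hn] with n h1 h2
    refine ⟨by positivity, ?_, ?_⟩
    · rw [div_le_one (by positivity)]; linarith
    · rw [div_pow, one_pow, one_div_mul_eq_div, div_div, le_div_iff₀ (by positivity)]
      linarith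
  · filter_upwards [hσ, eventually_ge_atTop 1] with n h1 hn1 ω hω S hS
    have hn0 : (0 : ℝ) < n := by exact_mod_cast hn1
    refine isUnit_and_inftyNorm_inv_le _ hn0 fun i => ?_
    have hterm : ∀ j : S,
        |((cols (X n ω) S)ᵀ * cols (X n ω) S - (n : ℝ) • (1 : Matrix S S ℝ)) i j|
        ≤ 1 / (2 * σ n) * n := fun j => by
      have h := hω i j
      have e : (1 : Matrix S S ℝ) i j = (1 : Matrix (Fin (p n)) (Fin (p n)) ℝ) i j := by
        simp only [Matrix.one_apply, Subtype.ext_iff]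
      rw [Matrix.sub_apply, Matrix.smul_apply] at h
      rw [Matrix.sub_apply, Matrix.smul_apply, e]
      exact h
    refine (Finset.sum_le_sum fun j _ => hterm j).trans ?_
    simp only [Finset.sum_const, Finset.card_univ, Fintype.card_coe, nsmul_eq_mul]
    have hS' : (S.card : ℝ) ≤ σ n := hS
    calc (S.card : ℝ) * (1 / (2 * σ n) * n) ≤ σ n * (1 / (2 * σ n) * n) := by gcongr
      _ = n / 2 := by field_simp

/-- Uniform control of the third moments over all sparse unit vectors. -/
theorem withProb_cubic (hX : ∀ n, IsIsotropicGaussian (P n) (X n)) (hp : Tendsto p atTop atTop)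
    {A : ℝ} (hA : 0 < A)
    (htail : ∀ᶠ n : ℕ in atTop, (stdGaussianPi n).real {y | A * n < ∑ i, |y i| ^ 3}
      ≤ 4 * Real.exp (-((n : ℝ) ^ (2 / 3 : ℝ) / 8))) {σ : ℕ → ℝ} (hσ : ∀ n, 0 ≤ σ n)
    (hn : ∀ᶠ n : ℕ in atTop, 48 * (σ n * Real.log (p n)) ≤ (n : ℝ) ^ (2 / 3 : ℝ)) :
    WithProbTendingToOne P (fun n ω => ∀ S ∈ sparseSupports (p n) (σ n),
      ∀ u : EuclideanSpace ℝ S, ‖u‖ = 1 →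
        (1 / n : ℝ) * ∑ i, |(cols (X n ω) S *ᵥ u.ofLp) i| ^ 3 ≤ 27 * A) := by
  refine (withProb_grid hX hA htail (m := fun n => ⌊σ n⌋₊) ?_).mono ?_
  · filter_upwards [hn, hp.eventually_ge_atTop 3] with n h1 hp3
    have hp3' : (3 : ℝ) ≤ p n := by exact_mod_cast hp3
    have hlog : 0 ≤ Real.log (p n) := Real.log_nonneg (by linarith)
    calc ((p n : ℝ) * (2 * p n + 1)) ^ ⌊σ n⌋₊ ≤ ((p n : ℝ) ^ 3) ^ ⌊σ n⌋₊ := by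
          gcongr
          nlinarith [mul_le_mul_of_nonneg_right hp3' (sq_nonneg (p n : ℝ))]
      _ = Real.exp (⌊σ n⌋₊ * (3 * Real.log (p n))) := by
          rw [Real.exp_nat_mul, show (3 : ℝ) = ((3 : ℕ) : ℝ) by norm_num, Real.exp_nat_mul,
            Real.exp_log (by linarith)]
      _ ≤ _ := by
          rw [Real.exp_le_exp]
          have : (⌊σ n⌋₊ : ℝ) * (3 * Real.log (p n)) ≤ σ n * (3 * Real.log (p n)) := by
            gcongr
            exact Nat.floor_le (hσ n)
          linarith
  · filter_upwards [eventually_ge_atTop 1, hp.eventually_ge_atTop 1] with n hn1 hp1 ω hω S hS u hu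
    have hn0 : (0 : ℝ) < n := by exact_mod_cast hn1
    have h := norm_cols_mulVec_le_of_grid hp1 (X n ω) (by positivity) hω (Nat.le_floor hS) hu
    have h3 := pow_le_pow_left₀ (norm_nonneg _) h 3
    have ha3 : ((A * n) ^ (1 / 3 : ℝ)) ^ 3 = A * n := by
      rw [← Real.rpow_natCast, ← Real.rpow_mul (by positivity)]; norm_num
    rw [norm_toLp_three_pow, mul_pow, ha3] at h3
    rw [one_div_mul_eq_div, div_le_iff₀ hn0]
    linarith

end Sequences

/-- The nearly well-specified supports and their unions with the true support are sparse; this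
is all that the bound for the third moments requires of them. -/
theorem nearSupportsBar_subset {n p : ℕ} (b : ℝ → ℝ) (Kdim Ktheta : ℝ)
    (θ₀ : EuclideanSpace ℝ (Fin p)) (X : Matrix (Fin n) (Fin p) ℝ) :
    nearSupportsBar b Kdim Ktheta θ₀ X ⊆ sparseSupports p ((Kdim + 1) * (supp θ₀).card) := by
  rintro S (hS | ⟨T, hT, rfl⟩)
  · have h : (S.card : ℝ) ≤ Kdim * (supp θ₀).card := hS.1
    have : (0 : ℝ) ≤ (supp θ₀).card := by positivity
    change (S.card : ℝ) ≤ _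
    linarith
  · have h : (T.card : ℝ) ≤ Kdim * (supp θ₀).card := hT.1
    have h2 : ((T ∪ supp θ₀).card : ℝ) ≤ T.card + (supp θ₀).card := by
      exact_mod_cast Finset.card_union_le _ _
    change ((T ∪ supp θ₀).card : ℝ) ≤ _
    linarith

theorem one_le_card_supp {p : ℕ} {θ : EuclideanSpace ℝ (Fin p)} (h : θ ≠ 0) :
    (1 : ℝ) ≤ (supp θ).card := by
  have : (supp θ).Nonempty := by
    by_contra hcon
    rw [Finset.not_nonempty_iff_eq_empty] at hcon
    refine h (PiLp.ext fun j => ?_)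
    by_contra hj
    have : j ∈ supp θ := by simpa [supp] using hj
    simp [hcon] at this
  exact_mod_cast this.card_pos

end SparseGLM

theorem corollary5p1 :
    ∃ Kinf Kcubic : ℝ, 0 < Kinf ∧ 0 < Kcubic ∧
    ∀ (Ω : ℕ → Type*) [∀ n, MeasurableSpace (Ω n)]
      (P : ∀ n, Measure (Ω n)) [∀ n, IsProbabilityMeasure (P n)]
      (p : ℕ → ℕ) (_hp : ∃ C : ℝ, 0 < C ∧ ∀ᶠ n : ℕ in atTop, (n : ℝ) ^ C ≤ p n)
      (θ₀ : ∀ n, EuclideanSpace ℝ (Fin (p n))) (_hθ₀ : ∀ᶠ n in atTop, θ₀ n ≠ 0)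
      (X : ∀ n, Ω n → Matrix (Fin n) (Fin (p n)) ℝ)
      (_hlaw : ∀ n i j, HasLaw (fun ω => X n ω i j) (gaussianReal 0 1) (P n))
      (_hindep : ∀ n, iIndepFun (fun (ij : Fin n × Fin (p n)) ω => X n ω ij.1 ij.2) (P n)),
      WithProbTendingToOne P (fun n ω =>
        maxNorm (X n ω) ≤ 2 * √(Real.log (n * p n)) ∧
        inftyNorm (cols (X n ω) (supp (θ₀ n)))
          ≤ 2 * (supp (θ₀ n)).card * √(Real.log (n * p n)) ∧
        maxColNorm (X n ω) ≤ √n + 2 * √(Real.log (p n)) ∧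
        (⨆ i, |(X n ω *ᵥ (θ₀ n).ofLp) i|) ≤ 2 * ‖θ₀ n‖ * √(Real.log n)) ∧
      ((fun n : ℕ => max (((supp (θ₀ n)).card : ℝ) ^ 2 * Real.log (p n))
          (((supp (θ₀ n)).card * Real.log (p n)) ^ (3 / 2 : ℝ)))
          =o[atTop] (fun n : ℕ => (n : ℝ)) →
        ∀ (b : ℝ → ℝ) (_hconv : StrictConvexOn ℝ Set.univ b)
          (_hdiff : ∀ r < 3, Differentiable ℝ (iteratedDeriv r b))
          (Kdim Ktheta : ℝ) (_hKdim : 1 < Kdim) (_hKtheta : 0 < Ktheta),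
        WithProbTendingToOne P (fun n ω =>
          (∀ S ∈ sparseSupports (p n) ((Kdim + 1) * (supp (θ₀ n)).card),
            IsUnit ((cols (X n ω) S)ᵀ * cols (X n ω) S) ∧
            inftyNorm ((cols (X n ω) S)ᵀ * cols (X n ω) S)⁻¹
              ≤ Kinf / n) ∧
          (∀ S ∈ nearSupportsBar b Kdim Ktheta (θ₀ n) (X n ω),
            ∀ u : EuclideanSpace ℝ S, ‖u‖ = 1 →
              (1 / n : ℝ) * ∑ i, |(cols (X n ω) S *ᵥ u.ofLp) i| ^ 3 ≤ Kcubic))) := by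
  obtain ⟨A, hA, htail⟩ := exists_stdGaussianPi_sum_cube
  refine ⟨2, 27 * A, two_pos, by positivity, ?_⟩
  intro Ω _ P _ p ⟨C, hC, hpC⟩ θ₀ hθ₀ X hlaw hindep
  have hp := tendsto_atTop_of_rpow_le hC hpC
  have hX : ∀ n, IsIsotropicGaussian (P n) (X n) := fun n =>
    isIsotropicGaussian_of_iid (hlaw n) (hindep n)
  refine ⟨withProb_norms hX hp θ₀, fun ho b _ _ Kdim Ktheta hKdim _ => ?_⟩
  have hs0 : ∀ n, 0 ≤ ((supp (θ₀ n)).card : ℝ) * Real.log (p n) := fun n =>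
    mul_nonneg (Nat.cast_nonneg _) (Real.log_natCast_nonneg _)
  have h1 := eventually_mul_sq_mul_le ho (K := 216 * (Kdim + 1) ^ 2) (by positivity)
  have h2 := eventually_mul_mul_le_rpow ho (K := 48 * (Kdim + 1)) (by positivity) hs0
  refine (withProb_gram_inv hX hp ?_ ?_).and ((withProb_cubic hX hp hA htail
    (σ := fun n => (Kdim + 1) * (supp (θ₀ n)).card) (fun n => by positivity) ?_).mono
    (Eventually.of_forall fun n ω h S hS => h S (nearSupportsBar_subset _ _ _ _ _ hS)))
  · filter_upwards [hθ₀] with n hn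
    nlinarith [one_le_card_supp hn]
  · filter_upwards [h1] with n hn
    linarith
  · filter_upwards [h2] with n hn
    linarith
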